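/- All graphs are finite and simple. The subdivision graph $S(G)$ of a graph $G$ is obtained by inserting a new vertex into every edge of $G$; let $I(G)$ be the set of inserted vertices. The subdivision-vertex join $G_1\dot\vee G_2$ is obtained from the disjoint union of $S(G_1)$ and $G_2$ by joining each vertex of $V(G_1)$ with every vertex of $V(G_2)$; the subdivision-edge join $G_1\veebar G_2$ is obtained from it by joining instead each vertex of $I(G_1)$ with every vertex of $V(G_2)$. The normalized Laplacian of a graph with adjacency matrix $A$ and degree matrix $D$ is $\mathcal L=I-D^{-1/2}AD^{-1/2}$, where the rows and columns of isolated vertices are taken to be zero; its spectrum is the list of all roots of its characteristic polynomial with multiplicity. The degree-Kirchhoff index of a connected graph $G$ is $Kf^*(G)=\sum_{\{u,v\}\subseteq V(G)}d(u)\,d(v)\,r(u,v)$, where $d$ is the degree and $r(u,v)$ is the resistance distance, i.e. the effective resistance between $u$ and $v$ when every edge is a unit resistor. **Theorem 3.3.** Let $G_1$ be an $r_1$-regular graph on $n_1\ge 1$ vertices with $m_1$ edges, and let $G_2$ be an $r_2$-regular graph on $n_2\ge 1$ vertices. Let $0=\mu_1,\mu_2,\dots,\mu_{n_1}$ and $0=\nu_1,\nu_2,\dots,\nu_{n_2}$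 be the normalized Laplacian spectra of $G_1$ and $G_2$. Then $G_1\dot\vee G_2$ is connected and $$Kf^*(G_1\dot\vee G_2)=(n_1r_1+n_2r_2+2n_1n_2+2m_1)\left(m_1-n_1+\frac{(r_1+n_2)(2r_2+3n_1)}{2n_1r_1+2n_1n_2+n_2r_2}+\sum_{i=2}^{n_1}\frac{4(r_1+n_2)}{2n_2+r_1\mu_i}+\sum_{i=2}^{n_2}\frac{r_2+n_1}{n_1+r_2\nu_i}\right).$$ If moreover $r_1\ge 1$, then $G_1\veebar G_2$ is connected and $$Kf^*(G_1\veebar G_2)=(n_1r_1+n_2r_2+2m_1n_2+2m_1)\left(m_1-n_1+\frac{(2+n_2)(2r_2+3m_1)}{4m_1+2m_1n_2+n_2r_2}+\sum_{i=2}^{n_1}\frac{4+2n_2}{n_2+\mu_i}+\sum_{i=2}^{n_2}\frac{r_2+m_1}{m_1+r_2\nu_i}\right).$$ -/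

import Mathlib

namespace SimpleGraph

/-- The subdivision graph `S(G)`: a new vertex is inserted into every edge of `G`. Its vertices are
the vertices of `G` (`Sum.inl`) and the inserted ones, one for each edge of `G` (`Sum.inr`); an
inserted vertex is adjacent exactly to the two ends of its edge. -/
def subdivision {V : Type*} (G : SimpleGraph V) : SimpleGraph (V ⊕ G.edgeSet) where
  Adj
    | .inl v, .inr e => v ∈ (e : Sym2 V)
    | .inr e, .inl v => v ∈ (e : Sym2 V)
    | .inl _, .inl _ => False
    | .inr _, .inr _ => False
  symm := ⟨by rintro (_ | _) (_ | _) h <;> exact h⟩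
  loopless := ⟨by rintro (_ | _) h <;> exact h⟩

/-- The graph obtained from the disjoint union of `H` and `K` by joining each vertex in `S`
with every vertex of `K`. -/
def joinAlong {A B : Type*} (H : SimpleGraph A) (S : Set A) (K : SimpleGraph B) :
    SimpleGraph (A ⊕ B) where
  Adj
    | .inl a, .inl a' => H.Adj a a'
    | .inr b, .inr b' => K.Adj b b'
    | .inl a, .inr _ => a ∈ S
    | .inr _, .inl a => a ∈ S
  symm := ⟨by
    rintro (_ | _) (_ | _) h
    · exact H.adj_symm h
    · exact h
    · exact h
    · exact K.adj_symm h⟩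
  loopless := ⟨by
    rintro (a | b) h
    · exact H.irrefl h
    · exact K.irrefl h⟩

/-- The subdivision-vertex join: `S(G₁)` and `G₂`, with each original vertex of `G₁` joined
with every vertex of `G₂`. -/
def subdivisionVertexJoin {V₁ V₂ : Type*} (G₁ : SimpleGraph V₁) (G₂ : SimpleGraph V₂) :
    SimpleGraph ((V₁ ⊕ G₁.edgeSet) ⊕ V₂) :=
  joinAlong G₁.subdivision (Set.range Sum.inl) G₂

/-- The subdivision-edge join: `S(G₁)` and `G₂`, with each inserted vertex of `S(G₁)` joined
with every vertex of `G₂`. -/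
def subdivisionEdgeJoin {V₁ V₂ : Type*} (G₁ : SimpleGraph V₁) (G₂ : SimpleGraph V₂) :
    SimpleGraph ((V₁ ⊕ G₁.edgeSet) ⊕ V₂) :=
  joinAlong G₁.subdivision (Set.range Sum.inr) G₂

open scoped Classical in
/-- The normalized Laplacian matrix `I - D^{-1/2} A D^{-1/2}`, with the usual convention that the
row and column of an isolated vertex (where `D^{-1/2}` is undefined) are zero. -/
noncomputable def normalizedLaplacian {V : Type*} [Fintype V] (G : SimpleGraph V) :
    Matrix V V ℝ :=
  Matrix.diagonal (fun v => if G.degree v = 0 then 0 else 1)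
    - Matrix.diagonal (fun v => (√(G.degree v : ℝ))⁻¹) * G.adjMatrix ℝ
      * Matrix.diagonal (fun v => (√(G.degree v : ℝ))⁻¹)

open scoped Classical in
/-- `lam 1, …, lam n` is the normalized Laplacian spectrum of `G` (a graph on `n` vertices): the
list of all roots of the characteristic polynomial, with multiplicity, in any order. -/
def IsNormalizedLaplacianSpectrum {V : Type*} [Fintype V] (G : SimpleGraph V) (lam : ℕ → ℝ) :
    Prop :=
  G.normalizedLaplacian.charpoly.roots =
    (Finset.Icc 1 (Fintype.card V)).val.map lam

open scoped Classical in
/-- `φ` is an electric potential on `G`, every edge being a unit resistor, when a unit current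
enters at `a` and leaves at `b`. By Ohm's law the current along an edge `uw` is `φ u - φ w`, so
the net current out of `u` is the `u`-entry of `L φ`, `L` the combinatorial Laplacian. -/
def IsUnitCurrentPotential {V : Type*} [Fintype V] (G : SimpleGraph V) (a b : V) (φ : V → ℝ) :
    Prop :=
  Matrix.mulVec (G.lapMatrix ℝ) φ = Pi.single a 1 - Pi.single b 1

open scoped Classical in
/-- The resistance distance between `a` and `b`: the potential difference caused by a unit current
from `a` to `b`. (The value `0` when there is no such current is irrelevant: in a connected graph
there always is one.) -/
noncomputable def resistanceDist {V : Type*} [Fintype V] (G : SimpleGraph V) (a b : V) : ℝ :=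
  if h : ∃ φ : V → ℝ, G.IsUnitCurrentPotential a b φ then h.choose a - h.choose b else 0

/-- The resistance distance does not depend on the choice of the potential. -/
theorem resistanceDist_eq {V : Type*} [Fintype V] (G : SimpleGraph V) {a b : V} {φ : V → ℝ}
    (hφ : G.IsUnitCurrentPotential a b φ) : G.resistanceDist a b = φ a - φ b := by
  classical
  have key : ∀ ψ : V → ℝ, G.IsUnitCurrentPotential a b ψ → ψ a - ψ b = φ a - φ b := by
    intro ψ hψ
    unfold IsUnitCurrentPotential at hφ hψ
    have h : φ ⬝ᵥ Matrix.mulVec (G.lapMatrix ℝ) ψ = ψ ⬝ᵥ Matrix.mulVec (G.lapMatrix ℝ) φ := by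
      rw [Matrix.dotProduct_mulVec, ← Matrix.mulVec_transpose,
        (G.isSymm_lapMatrix (R := ℝ)).eq, dotProduct_comm]
    convert_to φ ⬝ᵥ _ = ψ ⬝ᵥ _ at h
    rw [hφ, hψ] at h
    simp only [dotProduct_sub, dotProduct_single, mul_one] at h
    exact h.symm
  have h : ∃ φ : V → ℝ, G.IsUnitCurrentPotential a b φ := ⟨φ, hφ⟩
  rw [resistanceDist, dif_pos h]
  exact key _ h.choose_spec

open scoped Classical in
/-- The degree-Kirchhoff index `∑_{{a, b}} d(a) d(b) r(a, b)`, the sum over unordered pairs of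
vertices written as half the sum over ordered pairs. -/
noncomputable def degreeKirchhoffIndex {V : Type*} [Fintype V] (G : SimpleGraph V) : ℝ :=
  (1 / 2) * ∑ a, ∑ b, (G.degree a : ℝ) * (G.degree b : ℝ) * G.resistanceDist a b

end SimpleGraph

/-!
The combinatorial Laplacian `L` of either join has an explicit generalized inverse, and the
degree-Kirchhoff index is read off from it.

If `L X = 1 - u 1ᵀ`, then the columns of `X` give potentials for unit currents, so the resistance
distance is `X i i + X j j - X i j - X j i`, and summing over pairs of vertices gives
`Kf* = (∑ d i) * (∑ d i * X i i) - dᵀ X d` for the degree vector `d`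
(`degreeKirchhoffIndex_eq_of_lapMatrix_mul`). No relation with the normalized Laplacian spectrum of
the join is needed.

Both joins are handled at once: the vertices of `G₁` are joined with `G₂` with weight `a`, the
inserted vertices with weight `b`, where `(a, b)` is `(1, 0)` or `(0, 1)`. Let `d₁`, `d₂`, `r₂ + c`
be the resulting degrees, `R` the incidence matrix of `G₁`, `k = 1 / d₂`. A potential whose sum
over `G₂` vanishes does not see the coupling between `S(G₁)` and `G₂`, and eliminating the inserted
vertices leaves the Schur complement `M = d₁ - k R Rᵀ` on `G₁` and the matrix `N = c + L(G₂)` on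
`G₂`. So `X` is block diagonal, with blocks built from `M⁻¹` and `N⁻¹`
(`joinLaplacian_mul_joinInverse`).

Regularity makes `M = s + k r₁ 𝓛(G₁)` and `N = c + r₂ 𝓛(G₂)`, positive definite because normalized
Laplacians are positive semidefinite. By the spectral theorem the traces of the inverses are
`∑ 1 / (s + k r₁ μᵢ)` and `∑ 1 / (c + r₂ νᵢ)` (`trace_inv_smul_one_add_smul`), which are the sums in
the formulas; every other contribution to `Kf*` involves only the constant vector, an eigenvector of
all the matrices concerned.
-/

namespace Matrix

/-! ### Traces of inverses of shifted positive semidefinite matrices -/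

theorem trace_inv_smul_one_add_smul {n : Type*} [Fintype n] [DecidableEq n] {A : Matrix n n ℝ}
    (hA : A.PosSemidef) {c t : ℝ} (hc : 0 < c) (ht : 0 ≤ t) :
    IsUnit (c • (1 : Matrix n n ℝ) + t • A).det ∧
      (c • (1 : Matrix n n ℝ) + t • A)⁻¹.trace =
        (A.charpoly.roots.map fun x => (c + t * x)⁻¹).sum := by
  have hH := hA.isHermitian
  set U : Matrix n n ℝ := (hH.eigenvectorUnitary : Matrix n n ℝ) with hU
  have hUU : star U * U = 1 := by simp [hU]
  have hUU' : U * star U = 1 := by simp [hU]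
  set lam := hH.eigenvalues with hlam
  have hspec : A = U * diagonal lam * star U := by
    conv_lhs => rw [hH.spectral_theorem, Unitary.conjStarAlgAut_apply]
    rfl
  have hpos : ∀ i, c + t * lam i ≠ 0 := fun i => by
    have := mul_nonneg ht (hA.eigenvalues_nonneg i)
    exact (add_pos_of_pos_of_nonneg hc this).ne'
  have hconj : c • (1 : Matrix n n ℝ) + t • A =
      U * diagonal (fun i => c + t * lam i) * star U := by
    have : (diagonal (fun i => c + t * lam i) : Matrix n n ℝ) =
        c • (1 : Matrix n n ℝ) + t • diagonal lam := by
      ext i j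
      by_cases h : i = j <;> simp [h]
    rw [this, Matrix.mul_add, Matrix.add_mul, Matrix.mul_smul, smul_mul, Matrix.mul_smul, smul_mul,
      Matrix.mul_one, hUU', ← hspec]
  have hinv : (c • (1 : Matrix n n ℝ) + t • A) *
      (U * diagonal (fun i => (c + t * lam i)⁻¹) * star U) = 1 := by
    rw [hconj]
    calc _ = U * (diagonal (fun i => c + t * lam i) * (star U * U) *
          diagonal (fun i => (c + t * lam i)⁻¹)) * star U := by simp only [Matrix.mul_assoc]
      _ = 1 := by
        rw [hUU, Matrix.mul_one, diagonal_mul_diagonal]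
        simp [hpos, hUU']
  refine ⟨isUnit_det_of_right_inverse hinv, ?_⟩
  rw [inv_eq_right_inv hinv, trace_mul_comm, ← Matrix.mul_assoc, hUU, Matrix.one_mul,
    trace_diagonal, hH.roots_charpoly_eq_eigenvalues, Multiset.map_map]
  rfl

variable {V E W : Type*} [Fintype V] [Fintype E] [Fintype W]
  [DecidableEq V] [DecidableEq E] [DecidableEq W]

/-! ### All-ones matrices and constant row sums -/

/-- The all-ones matrix. -/
def ones (m n : Type*) : Matrix m n ℝ := of 1

theorem ones_mul {l m n : Type*} [Fintype m] {A : Matrix m n ℝ} {x : ℝ}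
    (h : 1 ᵥ* A = x • 1) : ones l m * A = x • ones l n := by
  ext i j
  simpa [ones, vecMul, dotProduct, mul_apply] using congrFun h j

theorem mul_ones {l m n : Type*} [Fintype m] {A : Matrix l m ℝ} {x : ℝ}
    (h : A *ᵥ 1 = x • 1) : A * ones m n = x • ones l n := by
  ext i j
  simpa [ones, mulVec, dotProduct, mul_apply] using congrFun h i

theorem ones_mul_ones (l m n : Type*) [Fintype m] :
    ones l m * ones m n = (Fintype.card m : ℝ) • ones l n := by
  ext i j
  simp [ones, mul_apply]

theorem ones_mul_sub_smul_ones {l n : Type*} [Fintype n] {Q : Matrix n n ℝ} {x : ℝ}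
    (h : 1 ᵥ* Q = x • 1) (hn : (Fintype.card n : ℝ) ≠ 0) :
    ones l n * (Q - (x * (Fintype.card n : ℝ)⁻¹) • ones n n) = 0 := by
  rw [Matrix.mul_sub, ones_mul h, Matrix.mul_smul, ones_mul_ones, smul_smul, mul_assoc,
    inv_mul_cancel₀ hn, mul_one, sub_self]

theorem inv_mulVec_one {n : Type*} [Fintype n] [DecidableEq n] {M : Matrix n n ℝ}
    (hM : IsUnit M.det) {s : ℝ} (hs : s ≠ 0) (h : M *ᵥ 1 = s • 1) : M⁻¹ *ᵥ 1 = s⁻¹ • 1 := by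
  have h1 : s • M⁻¹ *ᵥ 1 = (1 : n → ℝ) := by
    rw [← mulVec_smul, ← h, mulVec_mulVec, nonsing_inv_mul _ hM, one_mulVec]
  rw [← h1, smul_smul, inv_mul_cancel₀ hs, one_smul, h1]

variable {V E W : Type*} [Fintype V] [Fintype E] [Fintype W]
  [DecidableEq V] [DecidableEq E] [DecidableEq W]

/-! ### The block Laplacian of a join and its generalized inverse -/

/-- The block form of the Laplacian of a join: `R` is the vertex-edge incidence matrix, `d₁`, `d₂`
are the degrees of the original and of the inserted vertices, `N` is the block of the joined graph,
and `a`, `b` are `1` or `0` according to whether the original, respectively the inserted, vertices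
are joined with it. -/
def joinLaplacian (R : Matrix V E ℝ) (N : Matrix W W ℝ) (d₁ d₂ a b : ℝ) :
    Matrix ((V ⊕ E) ⊕ W) ((V ⊕ E) ⊕ W) ℝ :=
  fromBlocks (fromBlocks (d₁ • 1) (-R) (-Rᵀ) (d₂ • 1))
    (-fromRows (a • ones V W) (b • ones E W)) (-fromCols (a • ones W V) (b • ones W E)) N

/-- The generalized inverse of `joinLaplacian`. Its upper block inverts the Laplacian of the
subdivision part by eliminating the inserted vertices: `k` is the inverse of their degree and `P`
the inverse of the Schur complement. `Q` is the inverse of the block `N`, and `j` is to be chosen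
such that the columns of `Q - j • ones W W` sum to zero. -/
def joinInverse (R : Matrix V E ℝ) (P : Matrix V V ℝ) (Q : Matrix W W ℝ) (k j : ℝ) :
    Matrix ((V ⊕ E) ⊕ W) ((V ⊕ E) ⊕ W) ℝ :=
  fromBlocks (fromBlocks P (k • (P * R)) (k • (Rᵀ * P)) (k • 1 + k ^ 2 • (Rᵀ * (P * R))))
    0 0 (Q - j • ones W W)

/-- The Laplacian times its generalized inverse is `1 - u 1ᵀ`, where `u` is the inverse of
`Fintype.card W` on `W` and zero elsewhere. By `hsW`, the total conductance from
an original vertex to `W`, after elimination of the inserted vertices, is the row sum `s` of the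
Schur complement; by `hbW`, an inserted vertex has two neighbours in `V`. -/
theorem joinLaplacian_mul_joinInverse {R : Matrix V E ℝ} {N : Matrix W W ℝ}
    {P : Matrix V V ℝ} {Q : Matrix W W ℝ} {d₁ d₂ a b r c s : ℝ}
    (hd₂ : d₂ ≠ 0) (hc : c ≠ 0) (hs : s ≠ 0) (hW : (Fintype.card W : ℝ) ≠ 0)
    (hP : (d₁ • 1 - d₂⁻¹ • (R * Rᵀ)) * P = 1) (hQ : N * Q = 1)
    (hR : R *ᵥ 1 = r • 1) (hR' : 1 ᵥ* R = (2 : ℝ) • 1) (hP1 : 1 ᵥ* P = s⁻¹ • 1)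
    (hN1 : N *ᵥ 1 = c • 1) (hQ1 : 1 ᵥ* Q = c⁻¹ • 1)
    (hsW : (a + b * d₂⁻¹ * r) * Fintype.card W = s) (hbW : d₂ = 2 + b * Fintype.card W) :
    joinLaplacian R N d₁ d₂ a b * joinInverse R P Q d₂⁻¹ (c⁻¹ * (Fintype.card W : ℝ)⁻¹) =
      1 - fromBlocks 0 0 ((Fintype.card W : ℝ)⁻¹ • ones W (V ⊕ E))
        ((Fintype.card W : ℝ)⁻¹ • ones W W) := by
  set w := (Fintype.card W : ℝ) with hw
  have hP' : d₁ • P = 1 + d₂⁻¹ • (R * (Rᵀ * P)) := by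
    rw [Matrix.sub_mul, smul_mul, smul_mul, Matrix.one_mul, Matrix.mul_assoc] at hP
    rw [← hP, sub_add_cancel]
  have hP'' : d₁ • (P * R) = R + d₂⁻¹ • (R * (Rᵀ * (P * R))) := by
    rw [← smul_mul, hP', Matrix.add_mul, smul_mul, Matrix.one_mul]
    simp only [Matrix.mul_assoc]
  have hPJ := ones_mul (l := W) hP1
  have hRTJ := ones_mul (l := W) (show 1 ᵥ* Rᵀ = r • 1 by rw [vecMul_transpose, hR])
  have hRJ := ones_mul (l := W) hR'
  have hQV := ones_mul_sub_smul_ones (l := V) hQ1 hW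
  have hQE := ones_mul_sub_smul_ones (l := E) hQ1 hW
  have hNJ := mul_ones (n := W) hN1
  rw [joinLaplacian, joinInverse, fromBlocks_multiply, ← fromBlocks_one, ← fromBlocks_one,
    sub_eq_add_neg (fromBlocks _ _ _ _) (fromBlocks _ _ _ _), fromBlocks_neg, fromBlocks_add]
  congr 1
  · rw [fromBlocks_multiply, Matrix.mul_zero, add_zero, neg_zero, add_zero]
    congr 1
    · rw [smul_mul, Matrix.one_mul, Matrix.neg_mul, Matrix.mul_smul, hP']
      abel
    · rw [smul_mul, Matrix.one_mul, Matrix.neg_mul, smul_comm, hP'', Matrix.mul_add,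
        Matrix.mul_smul, Matrix.mul_smul, Matrix.mul_one, smul_add, smul_smul, ← sq, add_neg_cancel]
    · simp [hd₂]
    · rw [smul_mul, Matrix.one_mul, Matrix.neg_mul, Matrix.mul_smul, smul_add, smul_smul,
        smul_smul, mul_inv_cancel₀ hd₂, sq, ← mul_assoc, mul_inv_cancel₀ hd₂, one_mul, one_smul]
      abel
  · rw [Matrix.mul_zero, zero_add, neg_zero, add_zero, Matrix.neg_mul, fromRows_mul, smul_mul,
      smul_mul, hQV, hQE, smul_zero, smul_zero, fromRows_zero, neg_zero]
  · have hsplit : ones W (V ⊕ E) = fromCols (ones W V) (ones W E) := by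
      ext i (j | j) <;> rfl
    rw [Matrix.mul_zero, Matrix.neg_mul, fromCols_mul_fromBlocks, hsplit, zero_add, add_zero,
      Matrix.mul_add]
    simp only [smul_mul, Matrix.mul_smul, ← Matrix.mul_assoc, hPJ, hRTJ, hRJ, Matrix.mul_one,
      smul_smul, ← add_smul]
    -- The current that leaves the `V ⊕ E` part, seen from a source in `V`, respectively in `E`,
    -- spreads evenly over `W`.
    have hsum : (a + b * d₂⁻¹ * r) * s⁻¹ = w⁻¹ := by
      rw [← div_eq_mul_inv, div_eq_iff hs, ← hsW, mul_comm _ w, inv_mul_cancel_left₀ hW]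
    have hdeg : d₂⁻¹ * (2 * w⁻¹ + b) = w⁻¹ := by
      rw [inv_mul_eq_iff_eq_mul₀ hd₂, hbW, add_mul, mul_assoc, mul_inv_cancel₀ hW, mul_one]
    congr 1
    ext i (j | j)
    · simp only [fromCols_apply_inl, smul_apply, ones, of_apply, Pi.one_apply, smul_eq_mul]
      linear_combination hsum
    · simp only [fromCols_apply_inr, smul_apply, ones, of_apply, Pi.one_apply, smul_eq_mul]
      linear_combination 2 * d₂⁻¹ * hsum + hdeg
  · rw [Matrix.mul_zero, zero_add, Matrix.mul_sub, hQ, Matrix.mul_smul, hNJ, smul_smul,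
      mul_comm c⁻¹, mul_assoc, inv_mul_cancel₀ hc, mul_one, sub_eq_add_neg]

/-- The degree vector of a join: `d₁` on the original vertices, `d₂` on the inserted vertices and
`d₃` on the joined graph. -/
def joinDegree (V E W : Type*) (d₁ d₂ d₃ : ℝ) : (V ⊕ E) ⊕ W → ℝ :=
  Sum.elim (Sum.elim (d₁ • 1) (d₂ • 1)) (d₃ • 1)

omit [DecidableEq W] in
theorem sum_mul_diag_joinInverse {R : Matrix V E ℝ} {P : Matrix V V ℝ} {Q : Matrix W W ℝ}
    {d₁ d₂ d₃ j : ℝ} (hd₂ : d₂ ≠ 0) (hP : (d₁ • 1 - d₂⁻¹ • (R * Rᵀ)) * P = 1) :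
    ∑ i, joinDegree V E W d₁ d₂ d₃ i *
        joinInverse R P Q d₂⁻¹ j i i =
      2 * d₁ * P.trace + Fintype.card E - Fintype.card V +
        d₃ * (Q.trace - j * Fintype.card W) := by
  -- The trace of `(d₁ - d₂⁻¹ R Rᵀ) P = 1`.
  have htr : d₂⁻¹ * (Rᵀ * (P * R)).trace = d₁ * P.trace - Fintype.card V := by
    have h := congrArg trace hP
    rw [Matrix.sub_mul, smul_mul, smul_mul, Matrix.one_mul, trace_sub, trace_smul, trace_smul,
      trace_one, smul_eq_mul, smul_eq_mul, Matrix.mul_assoc, trace_mul_comm, Matrix.mul_assoc] at h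
    linarith
  have hV : ∑ v, P v v = P.trace := rfl
  have hW : ∑ v, Q v v = Q.trace := rfl
  have hE : ∑ e, (Rᵀ * (P * R)) e e = (Rᵀ * (P * R)).trace := rfl
  simp only [joinInverse, joinDegree, Fintype.sum_sum_type, Sum.elim_inl, Sum.elim_inr,
    fromBlocks_apply₁₁, fromBlocks_apply₂₂, add_apply, sub_apply, smul_apply, one_apply_eq,
    Pi.smul_apply, smul_eq_mul, mul_one, mul_add,
    mul_sub, Finset.sum_add_distrib, Finset.sum_sub_distrib, ← Finset.mul_sum, hV, hW, hE, ones,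
    of_apply, Pi.one_apply, Finset.sum_const, Finset.card_univ, nsmul_eq_mul]
  field_simp at htr ⊢
  linear_combination htr

omit [DecidableEq V] [DecidableEq E] in
/-- Double counting of the entries of `R`: the handshake lemma when `R` is an incidence matrix. -/
theorem card_mul_eq_two_mul_card {R : Matrix V E ℝ} {r : ℝ} (hR : R *ᵥ 1 = r • 1)
    (hR' : 1 ᵥ* R = (2 : ℝ) • 1) : Fintype.card V * r = 2 * Fintype.card E := by
  have h : (1 : V → ℝ) ⬝ᵥ R *ᵥ 1 = (1 ᵥ* R) ⬝ᵥ 1 := dotProduct_mulVec _ _ _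
  rw [hR, hR'] at h
  simpa [dotProduct, mul_comm] using h

omit [DecidableEq V] [DecidableEq W] in
theorem dotProduct_joinInverse_mulVec {R : Matrix V E ℝ} {P : Matrix V V ℝ} {Q : Matrix W W ℝ}
    {d₁ d₂ d₃ c r s : ℝ} (hd₂ : d₂ ≠ 0) (hW : (Fintype.card W : ℝ) ≠ 0)
    (hR : R *ᵥ 1 = r • 1) (hR' : 1 ᵥ* R = (2 : ℝ) • 1) (hP1 : P *ᵥ 1 = s⁻¹ • 1)
    (hQ1 : Q *ᵥ 1 = c⁻¹ • 1) :
    joinDegree V E W d₁ d₂ d₃ ⬝ᵥ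
        joinInverse R P Q d₂⁻¹ (c⁻¹ * (Fintype.card W : ℝ)⁻¹) *ᵥ
          joinDegree V E W d₁ d₂ d₃ =
      (d₁ + r) ^ 2 * s⁻¹ * Fintype.card V + d₂ * Fintype.card E := by
  have hRT : Rᵀ *ᵥ 1 = (2 : ℝ) • 1 := by rw [mulVec_transpose, hR']
  have hcount := card_mul_eq_two_mul_card hR hR'
  have hones : ones W W *ᵥ 1 = (Fintype.card W : ℝ) • 1 := by
    ext; simp [ones, mulVec, dotProduct]
  rw [joinDegree, joinInverse, fromBlocks_mulVec, fromBlocks_mulVec]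
  simp only [Sum.elim_comp_inl, Sum.elim_comp_inr, mulVec_smul, smul_mulVec, add_mulVec,
    sub_mulVec, ← mulVec_mulVec, hR, hP1, hRT, hQ1, hones, one_mulVec, zero_mulVec]
  simp only [dotProduct, Fintype.sum_sum_type, Sum.elim_inl, Sum.elim_inr, Pi.add_apply,
    Pi.sub_apply, Pi.smul_apply, Pi.one_apply, Pi.zero_apply, smul_eq_mul, mul_one,
    Finset.sum_const, Finset.card_univ, nsmul_eq_mul]
  generalize s⁻¹ = t
  field_simp
  linear_combination -(d₁ + r) * t * hcount

end Matrix

namespace SimpleGraph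

open Matrix

/-! ### The degree-Kirchhoff index from a generalized inverse -/

open scoped Classical in
/-- The degree-Kirchhoff index in terms of a matrix `X` such that `L X = 1 - u 1ᵀ`: for such an `X`
the vector `X (eᵢ - eⱼ)` is a potential of a unit current from `i` to `j`. -/
theorem degreeKirchhoffIndex_eq_of_lapMatrix_mul {V : Type*} [Fintype V] [DecidableEq V]
    (H : SimpleGraph V) {X : Matrix V V ℝ} {u d : V → ℝ} (hd : ∀ i, (H.degree i : ℝ) = d i)
    (hX : ∀ i j, (H.lapMatrix ℝ * X) i j = (1 : Matrix V V ℝ) i j - u i) :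
    H.degreeKirchhoffIndex = (∑ i, d i) * (∑ i, d i * X i i) - d ⬝ᵥ X *ᵥ d := by
  obtain rfl : ‹DecidableEq V› = fun i j => Classical.propDecidable (i = j) :=
    Subsingleton.elim _ _
  have hr (i j : V) : H.resistanceDist i j = X i i - X i j - (X j i - X j j) := by
    rw [H.resistanceDist_eq (φ := X *ᵥ (Pi.single i 1 - Pi.single j 1))]
    · simp [mulVec_sub]
    · unfold IsUnitCurrentPotential
      rw [mulVec_mulVec]
      ext k
      simp [mulVec_sub, hX, one_apply, Pi.single_apply]
  have e1 : ∑ i, ∑ j, d i * d j * X i i = (∑ i, d i) * ∑ i, d i * X i i := by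
    rw [mul_comm, Finset.sum_mul_sum]
    exact Finset.sum_congr rfl fun i _ => Finset.sum_congr rfl fun j _ => by ring
  have e2 : ∑ i, ∑ j, d i * d j * X j j = (∑ i, d i) * ∑ i, d i * X i i := by
    rw [Finset.sum_mul_sum]
    exact Finset.sum_congr rfl fun i _ => Finset.sum_congr rfl fun j _ => by ring
  have e3 : ∑ i, ∑ j, d i * d j * X i j = d ⬝ᵥ X *ᵥ d := by
    simp only [dotProduct, mulVec, Finset.mul_sum]
    exact Finset.sum_congr rfl fun i _ => Finset.sum_congr rfl fun j _ => by ring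
  have e4 : ∑ i, ∑ j, d i * d j * X j i = d ⬝ᵥ X *ᵥ d := by
    rw [Finset.sum_comm, ← e3]
    exact Finset.sum_congr rfl fun i _ => Finset.sum_congr rfl fun j _ => by ring
  rw [degreeKirchhoffIndex]
  simp only [hd, hr, mul_sub, Finset.sum_sub_distrib, e1, e2, e3, e4]
  ring

/-! ### The incidence matrix of a regular graph -/

variable {V : Type*} (G : SimpleGraph V)

open scoped Classical in
/-- The vertex-edge incidence matrix, with columns indexed by the edges only. -/
noncomputable def edgeIncidence : Matrix V G.edgeSet ℝ :=
  of fun v e => if v ∈ (e : Sym2 V) then 1 else 0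

open scoped Classical in
theorem edgeIncidence_apply_eq (v : V) (e : G.edgeSet) :
    G.edgeIncidence v e = G.incMatrix ℝ v e := by
  rw [incMatrix_apply']
  simp [edgeIncidence, incidenceSet, e.2]

variable [Fintype V]

open scoped Classical in
theorem sum_edgeSet_eq [Fintype G.edgeSet] (f : Sym2 V → ℝ) (hf : ∀ e ∉ G.edgeSet, f e = 0) :
    ∑ e : G.edgeSet, f e = ∑ e, f e := by
  rw [← Finset.sum_subset (Finset.subset_univ (Finset.univ.filter (· ∈ G.edgeSet)))
    (fun e _ he => hf e (by simpa using he))]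
  exact (Finset.sum_subtype _ (by simp) f).symm

variable {G} {r : ℕ}

open scoped Classical in
theorem edgeIncidence_mulVec_one [Fintype G.edgeSet]
    (hG : G.IsRegularOfDegree r) : G.edgeIncidence *ᵥ 1 = (r : ℝ) • 1 := by
  ext v
  have h := sum_incMatrix_apply (R := ℝ) (G := G) (a := v)
  rw [hG v, ← sum_edgeSet_eq G _
    fun e he => G.incMatrix_of_notMem_incidenceSet fun h => he h.1] at h
  simpa [mulVec, dotProduct, edgeIncidence_apply_eq] using h

theorem one_vecMul_edgeIncidence : 1 ᵥ* G.edgeIncidence = (2 : ℝ) • 1 := by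
  classical
  ext e
  simpa [vecMul, dotProduct, edgeIncidence_apply_eq] using
    sum_incMatrix_apply_of_mem_edgeSet (R := ℝ) (G := G) e.2

open scoped Classical in
theorem edgeIncidence_mul_transpose [Fintype G.edgeSet]
    (hG : G.IsRegularOfDegree r) :
    G.edgeIncidence * G.edgeIncidenceᵀ = (r : ℝ) • 1 + G.adjMatrix ℝ := by
  ext v w
  have h := congrFun₂ (G.incMatrix_mul_transpose (R := ℝ)) v w
  rw [mul_apply] at h
  simp only [transpose_apply] at h
  rw [← sum_edgeSet_eq G _ fun e he => by
    rw [G.incMatrix_of_notMem_incidenceSet fun h => he h.1, zero_mul]] at h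
  simp only [mul_apply, transpose_apply, edgeIncidence_apply_eq, h, of_apply, hG v]
  by_cases hvw : v = w
  · subst hvw
    simp
  · simp [hvw]

/-! ### Degrees and Laplacian of the joins -/

section join

variable {V W : Type*} {G : SimpleGraph V} {K : SimpleGraph W} {S : Set (V ⊕ G.edgeSet)}

@[simp]
theorem joinAlong_subdivision_adj_inl_inl_inl_inl {v v' : V} :
    ¬ (joinAlong G.subdivision S K).Adj (.inl (.inl v)) (.inl (.inl v')) := id

@[simp]
theorem joinAlong_subdivision_adj_inl_inr_inl_inr {e e' : G.edgeSet} :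
    ¬ (joinAlong G.subdivision S K).Adj (.inl (.inr e)) (.inl (.inr e')) := id

@[simp]
theorem joinAlong_subdivision_adj_inl_inl_inl_inr {v : V} {e : G.edgeSet} :
    (joinAlong G.subdivision S K).Adj (.inl (.inl v)) (.inl (.inr e)) ↔ v ∈ (e : Sym2 V) := .rfl

@[simp]
theorem joinAlong_subdivision_adj_inl_inr_inl_inl {v : V} {e : G.edgeSet} :
    (joinAlong G.subdivision S K).Adj (.inl (.inr e)) (.inl (.inl v)) ↔ v ∈ (e : Sym2 V) := .rfl

@[simp]
theorem joinAlong_adj_inl_inr {A B : Type*} {H : SimpleGraph A} {S : Set A} {K : SimpleGraph B}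
    {x : A} {y : B} : (joinAlong H S K).Adj (.inl x) (.inr y) ↔ x ∈ S := .rfl

@[simp]
theorem joinAlong_adj_inr_inl {A B : Type*} {H : SimpleGraph A} {S : Set A} {K : SimpleGraph B}
    {x : A} {y : B} : (joinAlong H S K).Adj (.inr y) (.inl x) ↔ x ∈ S := .rfl

@[simp]
theorem joinAlong_adj_inr_inr {A B : Type*} {H : SimpleGraph A} {S : Set A} {K : SimpleGraph B}
    {y y' : B} : (joinAlong H S K).Adj (.inr y) (.inr y') ↔ K.Adj y y' := .rfl

variable [Fintype V] [Fintype W] [Fintype G.edgeSet] {a b : ℝ} {r₁ r₂ : ℕ}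

open scoped Classical in
theorem degree_joinAlong_subdivision (hG : G.IsRegularOfDegree r₁) (hK : K.IsRegularOfDegree r₂)
    (ha : ∀ v, S.indicator 1 (Sum.inl v) = a)
    (hb : ∀ e, S.indicator 1 (Sum.inr e) = b) (x : (V ⊕ G.edgeSet) ⊕ W) :
    ((joinAlong G.subdivision S K).degree x : ℝ) =
      joinDegree V G.edgeSet W (r₁ + a * Fintype.card W) (2 + b * Fintype.card W)
        (r₂ + (a * Fintype.card V + b * Fintype.card G.edgeSet)) x := by
  have ha' (v : V) [Decidable (Sum.inl v ∈ S)] : (if Sum.inl v ∈ S then 1 else 0) = a := by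
    rw [← ha v, Set.indicator_apply]
    congr
  have hb' (e : G.edgeSet) [Decidable (Sum.inr e ∈ S)] :
      (if Sum.inr e ∈ S then 1 else 0) = b := by
    rw [← hb e, Set.indicator_apply]
    congr
  have hinc {v : V} {e : G.edgeSet} [Decidable (v ∈ (e : Sym2 V))] :
      (if v ∈ (e : Sym2 V) then 1 else 0) = G.edgeIncidence v e := by
    rw [edgeIncidence, of_apply]
    congr
  have hadj {w w' : W} [Decidable (K.Adj w w')] :
      (if K.Adj w w' then 1 else 0) = K.adjMatrix ℝ w w' := by
    rw [adjMatrix_apply]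
    congr
  rw [degree_eq_sum_if_adj, Fintype.sum_sum_type, Fintype.sum_sum_type]
  obtain ((v | e) | w) := x
  · have h := congrFun (edgeIncidence_mulVec_one hG) v
    simp only [mulVec, dotProduct, Pi.one_apply, mul_one, Pi.smul_apply, smul_eq_mul] at h
    simp [-Finset.sum_boole, joinDegree, ha', hinc, h, mul_comm]
  · have h := congrFun (one_vecMul_edgeIncidence (G := G)) e
    simp only [vecMul, dotProduct, Pi.one_apply, one_mul, Pi.smul_apply, smul_eq_mul,
      mul_one] at h
    simp [-Finset.sum_boole, joinDegree, hb', hinc, h, mul_comm]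
  · have h := K.degree_eq_sum_if_adj (R := ℝ) w
    simp only [hK w, hadj] at h
    simp [-Finset.sum_boole, -adjMatrix_apply, joinDegree, ha', hb', hadj, ← h]
    ring

open scoped Classical in
theorem lapMatrix_joinAlong_subdivision (hG : G.IsRegularOfDegree r₁)
    (hK : K.IsRegularOfDegree r₂)
    (ha : ∀ v, S.indicator 1 (Sum.inl v) = a)
    (hb : ∀ e, S.indicator 1 (Sum.inr e) = b) :
    (joinAlong G.subdivision S K).lapMatrix ℝ =
      joinLaplacian G.edgeIncidence
        ((a * Fintype.card V + b * Fintype.card G.edgeSet) • 1 + K.lapMatrix ℝ)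
        (r₁ + a * Fintype.card W) (2 + b * Fintype.card W) a b := by
  have ha' (v : V) [Decidable (Sum.inl v ∈ S)] : (if Sum.inl v ∈ S then 1 else 0) = a := by
    rw [← ha v, Set.indicator_apply]
    congr
  have hb' (e : G.edgeSet) [Decidable (Sum.inr e ∈ S)] :
      (if Sum.inr e ∈ S then 1 else 0) = b := by
    rw [← hb e, Set.indicator_apply]
    congr
  ext x y
  have hd := degree_joinAlong_subdivision hG hK ha hb x
  rw [lapMatrix, degMatrix, Matrix.sub_apply, diagonal_apply, hd, adjMatrix_apply]
  obtain ((v | e) | w) := x <;> obtain ((v' | e') | w') := y <;>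
    simp [joinLaplacian, joinDegree, edgeIncidence, ha', hb', ones,
      lapMatrix, degMatrix, diagonal_apply, one_apply, adjMatrix_apply, hK _]
  split_ifs <;> ring

end join

/-! ### The normalized Laplacian of a regular graph -/

section spectrum

variable {V : Type*} [Fintype V] {G : SimpleGraph V} {r : ℕ}

open scoped Classical in
/-- This includes `r = 0`, where both sides vanish. -/
theorem lapMatrix_eq_smul_normalizedLaplacian (hG : G.IsRegularOfDegree r) :
    G.lapMatrix ℝ = (r : ℝ) • G.normalizedLaplacian := by
  have hdeg (v : V) : G.degree v = r := hG v
  ext v w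
  rw [normalizedLaplacian, lapMatrix, degMatrix]
  simp only [Matrix.sub_apply, Matrix.smul_apply, diagonal_mul, mul_diagonal, diagonal_apply,
    hdeg, smul_eq_mul,
    adjMatrix_apply]
  rcases Nat.eq_zero_or_pos r with rfl | hr
  · have hadj : ¬ G.Adj v w := fun h => by
      have := (G.degree_pos_iff_exists_adj v).2 ⟨w, h⟩
      rw [hdeg] at this
      exact this.ne rfl
    simp [hadj]
  · have h0 : (√(r : ℝ))⁻¹ * (√(r : ℝ))⁻¹ * r = 1 := by
      rw [← mul_inv, Real.mul_self_sqrt (Nat.cast_nonneg r), inv_mul_cancel₀]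
      exact_mod_cast hr.ne'
    split_ifs <;> linarith

open scoped Classical in
theorem normalizedLaplacian_posSemidef (hG : G.IsRegularOfDegree r) :
    G.normalizedLaplacian.PosSemidef := by
  rcases Nat.eq_zero_or_pos r with rfl | hr
  · have hdeg (v : V) : G.degree v = 0 := hG v
    have h0 : G.normalizedLaplacian = 0 := by
      ext v w
      rw [normalizedLaplacian]
      simp [hdeg]
    rw [h0]
    exact PosSemidef.zero
  · have h := (G.posSemidef_lapMatrix ℝ).smul (inv_nonneg.2 (Nat.cast_nonneg (α := ℝ) r))
    rw [lapMatrix_eq_smul_normalizedLaplacian hG, smul_smul, inv_mul_cancel₀, one_smul] at h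
    · exact h
    · exact_mod_cast hr.ne'

open scoped Classical in
theorem IsNormalizedLaplacianSpectrum.sum_map_roots [Nonempty V] {lam : ℕ → ℝ}
    (h : G.IsNormalizedLaplacianSpectrum lam) (h1 : lam 1 = 0) (f : ℝ → ℝ) :
    (G.normalizedLaplacian.charpoly.roots.map f).sum =
      f 0 + ∑ i ∈ Finset.Icc 2 (Fintype.card V), f (lam i) := by
  have h' : G.normalizedLaplacian.charpoly.roots =
    (Finset.Icc 1 (Fintype.card V)).val.map lam := h
  rw [h', Multiset.map_map, ← h1]
  exact (Finset.add_sum_Ioc_eq_sum_Icc (f := f ∘ lam) Fintype.card_pos).symm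

end spectrum

/-! ### The degree-Kirchhoff index of the joins -/

section join

variable {V W : Type*} [Fintype V] [Fintype W] [Nonempty V] [Nonempty W]
  {G : SimpleGraph V} [Fintype G.edgeSet]
  {K : SimpleGraph W} {S : Set (V ⊕ G.edgeSet)} {a b : ℝ} {r₁ r₂ : ℕ}

open scoped Classical in
/-- The common form of the two formulas: `a` and `b` record whether the original and the inserted
vertices are joined with `K`, the numbers `d₁`, `d₂` and `r₂ + c` are the degrees, and `s` is the
eigenvalue of the Schur complement `d₁ - d₂⁻¹ R Rᵀ` at the constant vector. The terms `1 / c` from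
the first eigenvalue of `K` and from the correction of the `W`-block cancel. -/
theorem degreeKirchhoffIndex_joinAlong_subdivision
    (hG : G.IsRegularOfDegree r₁) (hK : K.IsRegularOfDegree r₂)
    (ha : ∀ v, S.indicator 1 (Sum.inl v) = a) (hb : ∀ e, S.indicator 1 (Sum.inr e) = b)
    {μ ν : ℕ → ℝ} (hμ : G.IsNormalizedLaplacianSpectrum μ) (hμ1 : μ 1 = 0)
    (hν : K.IsNormalizedLaplacianSpectrum ν) (hν1 : ν 1 = 0)
    {n₁ m n₂ d₁ d₂ c s : ℝ} (hn₁ : n₁ = Fintype.card V) (hm : m = Fintype.card G.edgeSet)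
    (hn₂ : n₂ = Fintype.card W) (hd₁ : d₁ = r₁ + a * n₂) (hd₂ : d₂ = 2 + b * n₂)
    (hc : c = a * n₁ + b * m) (hs : s = d₁ - 2 * r₁ * d₂⁻¹)
    (hd₂pos : 0 < d₂) (hcpos : 0 < c) (hspos : 0 < s) :
    (joinAlong G.subdivision S K).degreeKirchhoffIndex =
      (n₁ * d₁ + m * d₂ + n₂ * (r₂ + c)) *
        (2 * d₁ * (s⁻¹ + ∑ i ∈ Finset.Icc 2 (Fintype.card V), (s + d₂⁻¹ * r₁ * μ i)⁻¹) + m - n₁ +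
          (r₂ + c) * ∑ i ∈ Finset.Icc 2 (Fintype.card W), (c + r₂ * ν i)⁻¹) -
        ((d₁ + r₁) ^ 2 * s⁻¹ * n₁ + d₂ * m) := by
  have hn₂0 : n₂ ≠ 0 := by rw [hn₂]; exact_mod_cast Fintype.card_ne_zero
  have hW : (Fintype.card W : ℝ) ≠ 0 := hn₂ ▸ hn₂0
  set R := G.edgeIncidence with hRdef
  set M : Matrix V V ℝ := d₁ • 1 - d₂⁻¹ • (R * Rᵀ) with hM
  set N : Matrix W W ℝ := c • 1 + K.lapMatrix ℝ with hN
  have hR : R *ᵥ 1 = (r₁ : ℝ) • 1 := edgeIncidence_mulVec_one hG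
  have hR' : 1 ᵥ* R = (2 : ℝ) • 1 := one_vecMul_edgeIncidence
  have hM' : M = s • 1 + (d₂⁻¹ * r₁) • G.normalizedLaplacian := by
    have hlap : G.adjMatrix ℝ = (r₁ : ℝ) • 1 - (r₁ : ℝ) • G.normalizedLaplacian := by
      rw [← lapMatrix_eq_smul_normalizedLaplacian hG, lapMatrix, degMatrix]
      simp only [hG _]
      rw [← smul_one_eq_diagonal, sub_sub_cancel]
    rw [hM, hRdef, edgeIncidence_mul_transpose hG, hlap, hs]
    module
  have hN' : N = c • 1 + (r₂ : ℝ) • K.normalizedLaplacian := by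
    rw [hN, lapMatrix_eq_smul_normalizedLaplacian hK]
  obtain ⟨hMdet, hMtr⟩ := trace_inv_smul_one_add_smul (normalizedLaplacian_posSemidef hG) hspos
    (mul_nonneg (inv_nonneg.2 hd₂pos.le) (Nat.cast_nonneg (α := ℝ) r₁))
  obtain ⟨hNdet, hNtr⟩ := trace_inv_smul_one_add_smul (normalizedLaplacian_posSemidef hK) hcpos
    (Nat.cast_nonneg (α := ℝ) r₂)
  rw [← hM'] at hMdet hMtr
  rw [← hN'] at hNdet hNtr
  rw [hμ.sum_map_roots hμ1, mul_zero, add_zero] at hMtr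
  rw [hν.sum_map_roots hν1, mul_zero, add_zero] at hNtr
  have hM1 : M *ᵥ 1 = s • 1 := by
    rw [hM, sub_mulVec, smul_mulVec, smul_mulVec, one_mulVec, ← mulVec_mulVec, mulVec_transpose,
      hR', mulVec_smul, hR, hs]
    module
  have hN1 : N *ᵥ 1 = c • 1 := by
    rw [hN, add_mulVec, smul_mulVec, one_mulVec]
    exact (congrArg _ (lapMatrix_mulVec_const_eq_zero K)).trans (add_zero _)
  have hMsymm : Mᵀ = M := by simp [hM, transpose_sub, transpose_smul, transpose_mul]
  have hNsymm : Nᵀ = N := by simp [hN, (K.isSymm_lapMatrix (R := ℝ)).eq]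
  have hP1 := inv_mulVec_one hMdet hspos.ne' hM1
  have hQ1 := inv_mulVec_one hNdet hcpos.ne' hN1
  have hP1' : 1 ᵥ* M⁻¹ = s⁻¹ • 1 := by
    rw [← mulVec_transpose, transpose_nonsing_inv, hMsymm, hP1]
  have hQ1' : 1 ᵥ* N⁻¹ = c⁻¹ • 1 := by
    rw [← mulVec_transpose, transpose_nonsing_inv, hNsymm, hQ1]
  have hLX := joinLaplacian_mul_joinInverse (a := a) (b := b) hd₂pos.ne' hcpos.ne' hspos.ne' hW
    (mul_nonsing_inv M hMdet) (mul_nonsing_inv N hNdet) hR hR' hP1' hN1 hQ1'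
    (by
      rw [← hn₂, hs, hd₁]
      have h := mul_inv_cancel₀ hd₂pos.ne'
      linear_combination r₁ * h - r₁ * d₂⁻¹ * hd₂)
    (by rw [← hn₂, hd₂])
  have hlap := lapMatrix_joinAlong_subdivision hG hK ha hb
  have hdeg := degree_joinAlong_subdivision hG hK ha hb
  rw [← hn₂, ← hn₁, ← hm, ← hc, ← hd₁, ← hd₂] at hlap
  simp only [← hn₂, ← hn₁, ← hm, ← hc, ← hd₁, ← hd₂] at hdeg
  rw [degreeKirchhoffIndex_eq_of_lapMatrix_mul _ (u := Sum.elim 0 fun _ => n₂⁻¹)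
    (X := joinInverse R M⁻¹ N⁻¹ d₂⁻¹ (c⁻¹ * n₂⁻¹)) hdeg, sum_mul_diag_joinInverse hd₂pos.ne'
      (mul_nonsing_inv M hMdet), hn₂, dotProduct_joinInverse_mulVec hd₂pos.ne' hW hR hR' hP1 hQ1,
      hMtr, hNtr, ← hn₂, ← hn₁, ← hm]
  · have hsum : ∑ x, joinDegree V G.edgeSet W d₁ d₂ (r₂ + c) x =
        n₁ * d₁ + m * d₂ + n₂ * (r₂ + c) := by
      simp [joinDegree, Fintype.sum_sum_type, hn₁, hm, hn₂, mul_add]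
    rw [hsum, mul_assoc c⁻¹, inv_mul_cancel₀ hn₂0]
    ring
  · intro x y
    rw [hlap, hn₂, hLX]
    obtain (x | x) := x <;> obtain (y | y) := y <;> simp [ones]

open scoped Classical in
theorem degreeKirchhoffIndex_subdivisionVertexJoin
    (hG : G.IsRegularOfDegree r₁) (hK : K.IsRegularOfDegree r₂) {μ ν : ℕ → ℝ}
    (hμ : G.IsNormalizedLaplacianSpectrum μ) (hμ1 : μ 1 = 0)
    (hν : K.IsNormalizedLaplacianSpectrum ν) (hν1 : ν 1 = 0) {n₁ m₁ n₂ : ℕ}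
    (hn₁ : Fintype.card V = n₁) (hm₁ : Fintype.card G.edgeSet = m₁) (hn₂ : Fintype.card W = n₂) :
    (G.subdivisionVertexJoin K).degreeKirchhoffIndex =
      ((n₁ : ℝ) * r₁ + n₂ * r₂ + 2 * n₁ * n₂ + 2 * m₁) *
        ((m₁ : ℝ) - n₁
          + ((r₁ : ℝ) + n₂) * (2 * r₂ + 3 * n₁) / (2 * n₁ * r₁ + 2 * n₁ * n₂ + n₂ * r₂)
          + ∑ i ∈ Finset.Icc 2 n₁, 4 * ((r₁ : ℝ) + n₂) / (2 * n₂ + r₁ * μ i)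
          + ∑ i ∈ Finset.Icc 2 n₂, ((r₂ : ℝ) + n₁) / (n₁ + r₂ * ν i)) := by
  have hn₁0 : (0 : ℝ) < n₁ := by rw [← hn₁]; exact_mod_cast Fintype.card_pos
  have hn₂0 : (0 : ℝ) < n₂ := by rw [← hn₂]; exact_mod_cast Fintype.card_pos
  have hr₁0 : (0 : ℝ) ≤ r₁ := Nat.cast_nonneg _
  have hr₂0 : (0 : ℝ) ≤ r₂ := Nat.cast_nonneg _
  have hshake : (m₁ : ℝ) = n₁ * r₁ / 2 := by
    have h := card_mul_eq_two_mul_card (edgeIncidence_mulVec_one hG) one_vecMul_edgeIncidence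
    rw [hn₁, hm₁] at h
    linarith
  have key := degreeKirchhoffIndex_joinAlong_subdivision (S := Set.range Sum.inl) hG hK
    (a := 1) (b := 0) (fun v => Set.indicator_of_mem (Set.mem_range_self v) _)
    (fun e => Set.indicator_of_notMem (by simp) _) hμ hμ1 hν hν1 (n₁ := n₁) (m := m₁) (n₂ := n₂)
    (d₁ := r₁ + n₂) (d₂ := 2) (c := n₁) (s := n₂) (by rw [hn₁]) (by rw [hm₁]) (by rw [hn₂])
    (by ring) (by ring) (by ring) (by ring) two_pos hn₁0 hn₂0
  rw [subdivisionVertexJoin, key, hn₁, hn₂]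
  have hsum₁ : ∑ i ∈ Finset.Icc 2 n₁, 4 * ((r₁ : ℝ) + n₂) / (2 * n₂ + r₁ * μ i) =
      2 * (r₁ + n₂) * ∑ i ∈ Finset.Icc 2 n₁, ((n₂ : ℝ) + 2⁻¹ * r₁ * μ i)⁻¹ := by
    rw [Finset.mul_sum]
    refine Finset.sum_congr rfl fun i _ => ?_
    rw [show 2 * (n₂ : ℝ) + r₁ * μ i = 2 * (n₂ + 2⁻¹ * r₁ * μ i) by ring, div_eq_mul_inv, mul_inv]
    ring
  simp only [hsum₁, div_eq_mul_inv ((r₂ : ℝ) + n₁), ← Finset.mul_sum, hshake]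
  generalize ∑ i ∈ Finset.Icc 2 n₁, ((n₂ : ℝ) + 2⁻¹ * r₁ * μ i)⁻¹ = x
  generalize ∑ i ∈ Finset.Icc 2 n₂, ((n₁ : ℝ) + r₂ * ν i)⁻¹ = y
  have hpos : (0 : ℝ) < 2 * n₁ * r₁ + 2 * n₁ * n₂ + n₂ * r₂ := by positivity
  field_simp
  ring

open scoped Classical in
theorem degreeKirchhoffIndex_subdivisionEdgeJoin
    (hG : G.IsRegularOfDegree r₁) (hK : K.IsRegularOfDegree r₂) {μ ν : ℕ → ℝ}
    (hμ : G.IsNormalizedLaplacianSpectrum μ) (hμ1 : μ 1 = 0)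
    (hν : K.IsNormalizedLaplacianSpectrum ν) (hν1 : ν 1 = 0) {n₁ m₁ n₂ : ℕ}
    (hn₁ : Fintype.card V = n₁) (hm₁ : Fintype.card G.edgeSet = m₁) (hn₂ : Fintype.card W = n₂)
    (hr : 1 ≤ r₁) :
    (G.subdivisionEdgeJoin K).degreeKirchhoffIndex =
      ((n₁ : ℝ) * r₁ + n₂ * r₂ + 2 * m₁ * n₂ + 2 * m₁) *
        ((m₁ : ℝ) - n₁
          + (2 + (n₂ : ℝ)) * (2 * r₂ + 3 * m₁) / (4 * m₁ + 2 * m₁ * n₂ + n₂ * r₂)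
          + ∑ i ∈ Finset.Icc 2 n₁, (4 + 2 * (n₂ : ℝ)) / (n₂ + μ i)
          + ∑ i ∈ Finset.Icc 2 n₂, ((r₂ : ℝ) + m₁) / (m₁ + r₂ * ν i)) := by
  have hn₁0 : (0 : ℝ) < n₁ := by rw [← hn₁]; exact_mod_cast Fintype.card_pos
  have hn₂0 : (0 : ℝ) < n₂ := by rw [← hn₂]; exact_mod_cast Fintype.card_pos
  have hr₁0 : (0 : ℝ) ≤ r₁ := Nat.cast_nonneg _
  have hr₂0 : (0 : ℝ) ≤ r₂ := Nat.cast_nonneg _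
  have hshake : (m₁ : ℝ) = n₁ * r₁ / 2 := by
    have h := card_mul_eq_two_mul_card (edgeIncidence_mulVec_one hG) one_vecMul_edgeIncidence
    rw [hn₁, hm₁] at h
    linarith
  have hr₁pos : (0 : ℝ) < r₁ := by exact_mod_cast hr
  have hm₁0 : (0 : ℝ) < m₁ := by rw [hshake]; positivity
  have key := degreeKirchhoffIndex_joinAlong_subdivision (S := Set.range Sum.inr) hG hK
    (a := 0) (b := 1) (fun v => Set.indicator_of_notMem (by simp) _)
    (fun e => Set.indicator_of_mem (Set.mem_range_self e) _) hμ hμ1 hν hν1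
    (n₁ := n₁) (m := m₁) (n₂ := n₂) (d₁ := r₁) (d₂ := 2 + n₂) (c := m₁)
    (s := r₁ * n₂ / (2 + n₂)) (by rw [hn₁]) (by rw [hm₁]) (by rw [hn₂]) (by ring) (by ring)
    (by ring) (by field_simp; ring) (by positivity) hm₁0 (by positivity)
  rw [subdivisionEdgeJoin, key, hn₁, hn₂]
  have hsum₁ : ∑ i ∈ Finset.Icc 2 n₁, (4 + 2 * (n₂ : ℝ)) / (n₂ + μ i) =
      2 * r₁ * ∑ i ∈ Finset.Icc 2 n₁,
        ((r₁ * n₂ / (2 + n₂) : ℝ) + (2 + (n₂ : ℝ))⁻¹ * r₁ * μ i)⁻¹ := by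
    rw [Finset.mul_sum]
    refine Finset.sum_congr rfl fun i _ => ?_
    rw [show (r₁ * n₂ / (2 + n₂) : ℝ) + (2 + (n₂ : ℝ))⁻¹ * r₁ * μ i =
      r₁ * (2 + (n₂ : ℝ))⁻¹ * (n₂ + μ i) by ring, div_eq_mul_inv, mul_inv, mul_inv, inv_inv]
    field_simp
    ring
  simp only [hsum₁, div_eq_mul_inv ((r₂ : ℝ) + m₁), ← Finset.mul_sum]
  generalize ∑ i ∈ Finset.Icc 2 n₁,
    ((r₁ * n₂ / (2 + n₂) : ℝ) + (2 + (n₂ : ℝ))⁻¹ * r₁ * μ i)⁻¹ = x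
  generalize ∑ i ∈ Finset.Icc 2 n₂, ((m₁ : ℝ) + r₂ * ν i)⁻¹ = y
  have hpos : (0 : ℝ) < 4 * m₁ + 2 * m₁ * n₂ + n₂ * r₂ := by positivity
  rw [hshake] at hpos ⊢
  field_simp
  ring

end join

/-! ### Connectedness -/

theorem joinAlong_connected {A B : Type*} {H : SimpleGraph A} {S : Set A} {K : SimpleGraph B}
    [Nonempty B] (hS : S.Nonempty) (h : ∀ x ∉ S, ∃ y ∈ S, H.Adj x y) :
    (joinAlong H S K).Connected := by
  obtain ⟨b₀⟩ := ‹Nonempty B›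
  obtain ⟨s, hs⟩ := hS
  have hmem (x : A) (hx : x ∈ S) (b : B) : (joinAlong H S K).Reachable (.inl x) (.inr b) :=
    Adj.reachable (G := joinAlong H S K) (u := .inl x) (v := .inr b) hx
  have hall (z : A ⊕ B) : (joinAlong H S K).Reachable z (.inr b₀) := by
    obtain (x | b) := z
    · by_cases hx : x ∈ S
      · exact hmem x hx b₀
      · obtain ⟨y, hy, hxy⟩ := h x hx
        have hadj : (joinAlong H S K).Adj (.inl x) (.inl y) := hxy
        exact hadj.reachable.trans (hmem y hy b₀)
    · exact (hmem s hs b).symm.trans (hmem s hs b₀)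
  exact ⟨fun x y => (hall x).trans (hall y).symm⟩

theorem subdivisionVertexJoin_connected {V W : Type*} [Nonempty V] [Nonempty W]
    (G : SimpleGraph V) (K : SimpleGraph W) : (G.subdivisionVertexJoin K).Connected := by
  refine joinAlong_connected (Set.range_nonempty _) ?_
  rintro (v | ⟨e, he⟩) hx
  · exact absurd ⟨v, rfl⟩ hx
  · induction e with
    | h u w => exact ⟨.inl u, ⟨u, rfl⟩, Sym2.mem_mk_left u w⟩

theorem subdivisionEdgeJoin_connected {V W : Type*} [Nonempty V] [Nonempty W]
    {G : SimpleGraph V} (K : SimpleGraph W) (hG : ∀ v, ∃ w, G.Adj v w) :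
    (G.subdivisionEdgeJoin K).Connected := by
  have hinc (v : V) : ∃ e : G.edgeSet, v ∈ (e : Sym2 V) := by
    obtain ⟨w, hw⟩ := hG v
    exact ⟨⟨s(v, w), hw⟩, Sym2.mem_mk_left v w⟩
  refine joinAlong_connected ?_ ?_
  · obtain ⟨e, -⟩ := hinc (Classical.arbitrary V)
    exact ⟨.inr e, e, rfl⟩
  · rintro (v | e) hx
    · obtain ⟨e, he⟩ := hinc v
      exact ⟨.inr e, ⟨e, rfl⟩, he⟩
    · exact absurd ⟨e, rfl⟩ hx

end SimpleGraph

theorem theorem3p3 {V₁ V₂ : Type*} [Fintype V₁] [Fintype V₂] [DecidableEq V₁]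
    [Nonempty V₁] [Nonempty V₂]
    (G₁ : SimpleGraph V₁) (G₂ : SimpleGraph V₂) [DecidableRel G₁.Adj] [DecidableRel G₂.Adj]
    (n₁ m₁ r₁ n₂ r₂ : ℕ)
    (hn₁ : Fintype.card V₁ = n₁) (hm₁ : G₁.edgeFinset.card = m₁)
    (hr₁ : G₁.IsRegularOfDegree r₁)
    (hn₂ : Fintype.card V₂ = n₂) (hr₂ : G₂.IsRegularOfDegree r₂)
    (μ ν : ℕ → ℝ)
    (hμ : G₁.IsNormalizedLaplacianSpectrum μ) (hμ1 : μ 1 = 0)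
    (hν : G₂.IsNormalizedLaplacianSpectrum ν) (hν1 : ν 1 = 0) :
    ((G₁.subdivisionVertexJoin G₂).Connected ∧
      (G₁.subdivisionVertexJoin G₂).degreeKirchhoffIndex =
        ((n₁ : ℝ) * r₁ + n₂ * r₂ + 2 * n₁ * n₂ + 2 * m₁) *
          ((m₁ : ℝ) - n₁
            + ((r₁ : ℝ) + n₂) * (2 * r₂ + 3 * n₁) / (2 * n₁ * r₁ + 2 * n₁ * n₂ + n₂ * r₂)
            + ∑ i ∈ Finset.Icc 2 n₁, 4 * ((r₁ : ℝ) + n₂) / (2 * n₂ + r₁ * μ i)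
            + ∑ i ∈ Finset.Icc 2 n₂, ((r₂ : ℝ) + n₁) / (n₁ + r₂ * ν i))) ∧
    (1 ≤ r₁ →
      (G₁.subdivisionEdgeJoin G₂).Connected ∧
      (G₁.subdivisionEdgeJoin G₂).degreeKirchhoffIndex =
        ((n₁ : ℝ) * r₁ + n₂ * r₂ + 2 * m₁ * n₂ + 2 * m₁) *
          ((m₁ : ℝ) - n₁
            + (2 + (n₂ : ℝ)) * (2 * r₂ + 3 * m₁) / (4 * m₁ + 2 * m₁ * n₂ + n₂ * r₂)
            + ∑ i ∈ Finset.Icc 2 n₁, (4 + 2 * (n₂ : ℝ)) / (n₂ + μ i)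
            + ∑ i ∈ Finset.Icc 2 n₂, ((r₂ : ℝ) + m₁) / (m₁ + r₂ * ν i))) := by
  have hm : Fintype.card G₁.edgeSet = m₁ := by rw [← hm₁, SimpleGraph.edgeFinset_card]
  refine ⟨⟨G₁.subdivisionVertexJoin_connected G₂,
    SimpleGraph.degreeKirchhoffIndex_subdivisionVertexJoin (fun v => by convert hr₁ v)
      (fun v => by convert hr₂ v) hμ hμ1 hν hν1 hn₁ hm hn₂⟩, fun hr =>
    ⟨SimpleGraph.subdivisionEdgeJoin_connected G₂ fun v =>
      (G₁.degree_pos_iff_exists_adj v).1 (by rw [hr₁ v]; exact hr),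
    SimpleGraph.degreeKirchhoffIndex_subdivisionEdgeJoin (fun v => by convert hr₁ v)
      (fun v => by convert hr₂ v) hμ hμ1 hν hν1 hn₁ hm hn₂ hr⟩⟩
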